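/- For an even integer $k\ge 4$ and $\tau$ in the complex upper half-plane $\mathbb{H}$, let $$G_k(\tau)=\sum_{(m,n)\in\mathbb{Z}^2\setminus\{(0,0)\}}(m\tau+n)^{-k}.$$ Theorem 1.1. For every integer $n\ge 1$, the following identity of functions on $\mathbb{H}$ holds: $$G_{6n+2}=\frac{1}{6n+1}\cdot\frac{(4n+1)!}{(2n)!^2}\sum_{k=1}^{n}\frac{\binom{2n}{2k-1}}{\binom{6n}{2n+2k-1}}\,G_{2n+2k}\,G_{4n-2k+2}.$$ -/

import Mathlib

open scoped UpperHalfPlane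

/-- The Eisenstein series
`G_k(τ) = ∑ (mτ + n)^(-k)`, the sum over all `(m, n) ∈ ℤ² ∖ {(0, 0)}`.
It is the unconditional sum, hence the intended function for every weight `k ≥ 3`
(see `eisensteinG_summable`); weight `2`, where an order of summation has to be
chosen, is not covered. -/
noncomputable def eisensteinG (k : ℕ) (τ : ℍ) : ℂ :=
  ∑' p : {p : ℤ × ℤ // p ≠ (0, 0)}, ((p.1.1 : ℂ) * (τ : ℂ) + (p.1.2 : ℂ)) ^ (-(k : ℤ))

/-- For `k ≥ 3` the defining series converges absolutely. -/
theorem eisensteinG_summable (k : ℕ) (hk : 3 ≤ k) (τ : ℍ) :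
    Summable (fun p : {p : ℤ × ℤ // p ≠ (0, 0)} =>
      ((p.1.1 : ℂ) * (τ : ℂ) + (p.1.2 : ℂ)) ^ (-(k : ℤ))) := by
  have h := (EisensteinSeries.summable_norm_eisSummand (k := (k : ℤ)) (by exact_mod_cast hk) τ).of_norm
  have h2 := ((finTwoArrowEquiv ℤ).symm.summable_iff.mpr h).subtype {p : ℤ × ℤ | p ≠ (0, 0)}
  refine h2.congr fun p => ?_
  simp [EisensteinSeries.eisSummand, finTwoArrowEquiv]

/-! ### Residues of a rational function with three poles -/

section ResidueIdentity

open PowerSeries LaurentSeries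

variable {K : Type*} [Field K]

/-! Put `d = 2n`. For distinct `0, x, y`, the residues of `(u (u + x) (u + y))⁻¹ ^ (d + 1)` sum to
zero; each is a `tripleResidue`, at `(x, y)`, `(-x, y - x)` and `(-y, x - y)`. Summed over pairs of
distinct lattice points, the three terms are reindexings of one absolutely convergent series, which
therefore vanishes. It is the sum over all pairs, a combination of products of Eisenstein series,
minus the diagonal, a multiple of `G_(3d+2)`. Odd weights vanish, and the binomial coefficients are
then matched. -/

/-- The factor `X + t`, as a Laurent series. -/
noncomputable def shiftedVar (t : K) : K⸨X⸩ := ((X + C t : K⟦X⟧) : K⸨X⸩)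

theorem shiftedVar_ne_zero (t : K) : shiftedVar t ≠ 0 := by
  have h : (X + C t : K⟦X⟧) ≠ 0 := by
    intro h
    simpa [coeff_X] using congrArg (coeff 1) h
  intro h'
  apply h
  have : Function.Injective (HahnSeries.ofPowerSeries ℤ K) := HahnSeries.ofPowerSeries_injective
  apply this
  rw [map_zero]
  exact h'

theorem shiftedVar_sub (s t : K) : shiftedVar s - shiftedVar t = HahnSeries.C (s - t) := by
  simp [shiftedVar, PowerSeries.coe_add]

theorem shiftedVar_zero : shiftedVar (0 : K) = HahnSeries.single 1 1 := by
  simp [shiftedVar]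

/-- The expansion of `(X + t)⁻¹ ^ (d + 1)` at `0`, for `t ≠ 0`. -/
theorem inv_shiftedVar_pow_succ {t : K} (ht : t ≠ 0) (d : ℕ) :
    (shiftedVar t)⁻¹ ^ (d + 1) =
      ((PowerSeries.mk fun i => ((d + i).choose d : K) * (-1) ^ i * t⁻¹ ^ (d + 1 + i) : K⟦X⟧) :
        K⸨X⸩) := by
  have hmul : (X + C t) * (C t⁻¹ * rescale (-t⁻¹) (PowerSeries.mk 1)) = (1 : K⟦X⟧) := by
    have h := congrArg (rescale (-t⁻¹)) (mk_one_mul_one_sub_eq_one K)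
    simp only [map_mul, map_sub, map_one, rescale_X, map_neg] at h
    have ht' : (C t * C t⁻¹ : K⟦X⟧) = 1 := by rw [← map_mul, mul_inv_cancel₀ ht, map_one]
    linear_combination h + rescale (-t⁻¹) (PowerSeries.mk 1) * ht'
  have hinv : (shiftedVar t)⁻¹ =
      ((C t⁻¹ * rescale (-t⁻¹) (PowerSeries.mk 1) : K⟦X⟧) : K⸨X⸩) := by
    refine inv_eq_of_mul_eq_one_right ?_
    rw [shiftedVar, ← PowerSeries.coe_mul, hmul, PowerSeries.coe_one]
  rw [hinv, ← PowerSeries.coe_pow, mul_pow, ← map_pow, ← map_pow, mk_one_pow_eq_mk_choose_add]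
  congr 1
  ext i
  rw [coeff_C_mul, coeff_rescale, coeff_mk, coeff_mk, neg_pow]
  ring

theorem coeff_neg_one_inv_shiftedVar_pow {t : K} (ht : t ≠ 0) (a : ℕ) :
    ((shiftedVar t)⁻¹ ^ a).coeff (-1) = 0 := by
  cases a with
  | zero => simp [HahnSeries.coeff_one]
  | succ d =>
    rw [inv_shiftedVar_pow_succ ht, PowerSeries.coeff_coe]
    simp

theorem coeff_neg_one_inv_shiftedVar_zero_pow (a : ℕ) :
    ((shiftedVar (0 : K))⁻¹ ^ a).coeff (-1) = if a = 1 then 1 else 0 := by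
  rw [shiftedVar_zero, HahnSeries.inv_single, HahnSeries.single_pow, HahnSeries.coeff_single]
  have h : (-1 : ℤ) = a • (-1 : ℤ) ↔ a = 1 := by
    rw [nsmul_eq_mul]
    omega
  simp only [h, inv_one, one_pow]

/-- The residue at `s` of `(u - p)⁻ᵃ (u - q)⁻ᵇ (u - r)⁻ᶜ`. -/
noncomputable def residueAt (p q r : K) (a b c : ℕ) (s : K) : K :=
  ((shiftedVar (s - p))⁻¹ ^ a * (shiftedVar (s - q))⁻¹ ^ b * (shiftedVar (s - r))⁻¹ ^ c).coeff (-1)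

theorem residueAt_rotate (p q r : K) (a b c : ℕ) (s : K) :
    residueAt p q r a b c s = residueAt q r p b c a s := by
  unfold residueAt
  congr 1
  ring

/-- Partial fractions: `(p - q) / ((u - p)(u - q)) = 1 / (u - p) - 1 / (u - q)`. -/
theorem residueAt_recurrence (p q r : K) (a b c : ℕ) (s : K) :
    (p - q) * residueAt p q r (a + 1) (b + 1) c s =
      residueAt p q r (a + 1) b c s - residueAt p q r a (b + 1) c s := by
  unfold residueAt
  rw [← HahnSeries.coeff_sub, ← smul_eq_mul, ← HahnSeries.coeff_smul]
  congr 1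
  rw [← HahnSeries.C_mul_eq_smul]
  have h : HahnSeries.C (p - q) = shiftedVar (s - q) - shiftedVar (s - p) := by
    rw [shiftedVar_sub]; congr 1; ring
  rw [h]
  have h1 := shiftedVar_ne_zero (s - p)
  have h2 := shiftedVar_ne_zero (s - q)
  generalize shiftedVar (s - p) = x at *
  generalize shiftedVar (s - q) = y at *
  have e1 : x * x⁻¹ = 1 := mul_inv_cancel₀ h1
  have e2 : y * y⁻¹ = 1 := mul_inv_cancel₀ h2
  rw [pow_succ, pow_succ]
  linear_combination (x⁻¹ ^ a * y⁻¹ ^ b * (shiftedVar (s - r))⁻¹ ^ c) * (x⁻¹ * e2 - y⁻¹ * e1)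

/-- The sum of the residues of `(u - p)⁻ᵃ (u - q)⁻ᵇ (u - r)⁻ᶜ` at its finite poles. -/
noncomputable def residueSum (p q r : K) (a b c : ℕ) : K :=
  residueAt p q r a b c p + residueAt p q r a b c q + residueAt p q r a b c r

theorem residueSum_rotate (p q r : K) (a b c : ℕ) :
    residueSum p q r a b c = residueSum q r p b c a := by
  simp only [residueSum, residueAt_rotate p q r a b c]
  ring

theorem residueSum_recurrence (p q r : K) (a b c : ℕ) :
    (p - q) * residueSum p q r (a + 1) (b + 1) c =
      residueSum p q r (a + 1) b c - residueSum p q r a (b + 1) c := by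
  simp only [residueSum, mul_add, residueAt_recurrence]
  ring

theorem residueSum_single {p q r : K} (hpq : p ≠ q) (hpr : p ≠ r) (a : ℕ) :
    residueSum p q r a 0 0 = if a = 1 then 1 else 0 := by
  simp only [residueSum, residueAt, pow_zero, mul_one, sub_self,
    coeff_neg_one_inv_shiftedVar_zero_pow,
    coeff_neg_one_inv_shiftedVar_pow (sub_ne_zero.mpr hpq.symm),
    coeff_neg_one_inv_shiftedVar_pow (sub_ne_zero.mpr hpr.symm), add_zero]

/-- Replaces the residue at infinity. If two exponents are positive, the recurrence gives a
difference of two sums of equal lower total degree, which cancel by induction; otherwise there is at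
most one pole. -/
theorem residueSum_eq (m : ℕ) {p q r : K} (hpq : p ≠ q) (hqr : q ≠ r) (hrp : r ≠ p) (a b c : ℕ)
    (h : a + b + c = m) : residueSum p q r a b c = if m = 1 then 1 else 0 := by
  induction m using Nat.strong_induction_on generalizing p q r a b c with
  | _ m ih =>
    have step : ∀ {p q r : K}, p ≠ q → q ≠ r → r ≠ p → ∀ a b c : ℕ, a + 1 + (b + 1) + c = m →
        residueSum p q r (a + 1) (b + 1) c = if m = 1 then 1 else 0 := by
      intro p q r hpq hqr hrp a b c h
      have h' := residueSum_recurrence p q r a b c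
      rw [ih (m - 1) (by omega) hpq hqr hrp (a + 1) b c (by omega),
        ih (m - 1) (by omega) hpq hqr hrp a (b + 1) c (by omega), sub_self] at h'
      rw [if_neg (by omega)]
      exact (mul_eq_zero.mp h').resolve_left (sub_ne_zero.mpr hpq)
    rcases a with _ | a
    · rcases b with _ | b
      · rw [residueSum_rotate, residueSum_rotate, residueSum_single hrp hqr.symm]
        simp [← h]
      · rcases c with _ | c
        · rw [residueSum_rotate, residueSum_single hqr hpq.symm]
          simp [← h]
        · rw [residueSum_rotate]
          exact step hqr hrp hpq b c 0 (by omega)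
    · rcases b with _ | b
      · rcases c with _ | c
        · rw [residueSum_single hpq hrp.symm]
          simp [← h]
        · rw [residueSum_rotate, residueSum_rotate]
          exact step hrp hpq hqr c a 0 (by omega)
      · exact step hpq hqr hrp a b c h

/-- The residue at `0` of `(u (u + x) (u + y))⁻¹ ^ (d + 1)`, for `d` even and `x, y ≠ 0`. -/
def tripleResidue (d : ℕ) (x y : K) : K :=
  ∑ ij ∈ Finset.HasAntidiagonal.antidiagonal d, ((d + ij.1).choose d : K) * ((d + ij.2).choose d : K) *
    (x⁻¹ ^ (d + 1 + ij.1) * y⁻¹ ^ (d + 1 + ij.2))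

theorem residueAt_self {d : ℕ} (hd : Even d) {x y : K} (hx : x ≠ 0) (hy : y ≠ 0) :
    ((shiftedVar 0)⁻¹ ^ (d + 1) * (shiftedVar x)⁻¹ ^ (d + 1) *
      (shiftedVar y)⁻¹ ^ (d + 1)).coeff (-1) = tripleResidue d x y := by
  rw [mul_assoc, inv_shiftedVar_pow_succ hx, inv_shiftedVar_pow_succ hy, ← PowerSeries.coe_mul,
    shiftedVar_zero, HahnSeries.inv_single, HahnSeries.single_pow]
  -- The pole at `0` has order `d + 1`, so the residue is the `d`-th Taylor coefficient of the other
  -- two factors.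
  have h : (-1 : ℤ) = (d : ℤ) + (d + 1) • (-1 : ℤ) := by
    rw [nsmul_eq_mul]
    push_cast
    ring
  rw [congrArg (HahnSeries.coeff _) h, HahnSeries.coeff_single_mul_add, coeff_coe_powerSeries, coeff_mul, inv_one, one_pow,
    one_mul, tripleResidue]
  refine Finset.sum_congr rfl fun ij hij => ?_
  have hs : ((-1 : K) ^ ij.1) * (-1) ^ ij.2 = 1 := by
    rw [← pow_add, Finset.HasAntidiagonal.mem_antidiagonal.mp hij, hd.neg_one_pow]
  rw [coeff_mk, coeff_mk]
  linear_combination ((d + ij.1).choose d : K) * ((d + ij.2).choose d : K) *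
    (x⁻¹ ^ (d + 1 + ij.1) * y⁻¹ ^ (d + 1 + ij.2)) * hs

theorem tripleResidue_add_add_eq_zero {d : ℕ} (hd : Even d) {x y : K} (hx : x ≠ 0) (hy : y ≠ 0)
    (hxy : x ≠ y) :
    tripleResidue d x y + tripleResidue d (-x) (y - x) + tripleResidue d (-y) (x - y) = 0 := by
  have h := residueSum_eq _ (p := 0) (q := -x) (r := -y) (by simpa [eq_comm] using hx)
    (by simpa using hxy) (by simpa using hy) (d + 1) (d + 1) (d + 1) rfl
  rw [if_neg (by omega), residueSum, residueAt_rotate 0 (-x) (-y) _ _ _ (-x),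
    ← residueAt_rotate (-y) 0 (-x) _ _ _ (-y)] at h
  rw [← residueAt_self hd hx hy, ← residueAt_self hd (neg_ne_zero.mpr hx) (sub_ne_zero.mpr hxy.symm),
    ← residueAt_self hd (neg_ne_zero.mpr hy) (sub_ne_zero.mpr hxy)]
  refine Eq.trans ?_ h
  simp only [residueAt, sub_neg_eq_add, sub_self, zero_add, sub_zero, neg_add_eq_sub]
  rw [mul_right_comm _ ((shiftedVar (-x))⁻¹ ^ (d + 1))]

end ResidueIdentity

/-! ### Summation over pairs of lattice points -/

section LatticeSums

/-- The lattice point `m τ + n`. -/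
def latticePoint (τ : ℍ) : ℤ × ℤ →+ ℂ where
  toFun p := (p.1 : ℂ) * τ + p.2
  map_zero' := by simp
  map_add' p q := by simp only [Prod.fst_add, Prod.snd_add]; push_cast; ring

theorem latticePoint_eq_zero {τ : ℍ} {p : ℤ × ℤ} : latticePoint τ p = 0 ↔ p = 0 := by
  refine ⟨fun h => ?_, fun h => by rw [h, map_zero]⟩
  change (p.1 : ℂ) * τ + p.2 = 0 at h
  have him := congrArg Complex.im h
  have h1 : p.1 = 0 := by simpa [τ.im_ne_zero] using him
  have h2 : p.2 = 0 := by simpa [h1] using h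
  exact Prod.ext h1 h2

theorem latticePoint_injective (τ : ℍ) : Function.Injective (latticePoint τ) :=
  (injective_iff_map_eq_zero _).mpr fun _ => latticePoint_eq_zero.mp

theorem support_latticePoint_inv_pow {k : ℕ} (hk : k ≠ 0) (τ : ℍ) :
    (fun p => (latticePoint τ p)⁻¹ ^ k).support ⊆ {p : ℤ × ℤ | p ≠ (0, 0)} := by
  rintro p hp rfl
  exact hp (by simp [latticePoint, hk])

theorem eisensteinG_eq_tsum {k : ℕ} (hk : k ≠ 0) (τ : ℍ) :
    eisensteinG k τ = ∑' p, (latticePoint τ p)⁻¹ ^ k := by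
  rw [← tsum_subtype_eq_of_support_subset (support_latticePoint_inv_pow hk τ)]
  exact tsum_congr fun p => by rw [zpow_neg, zpow_natCast, inv_pow]; rfl

theorem summable_norm_latticePoint_inv_pow {k : ℕ} (hk : 3 ≤ k) (τ : ℍ) :
    Summable fun p => ‖(latticePoint τ p)⁻¹ ^ k‖ := by
  have h := eisensteinG_summable k hk τ
  have h' : Summable ((fun p => (latticePoint τ p)⁻¹ ^ k) ∘
      ((↑) : {p : ℤ × ℤ | p ≠ (0, 0)} → ℤ × ℤ)) :=
    h.congr fun p => by rw [zpow_neg, zpow_natCast, ← inv_pow]; rfl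
  rw [summable_subtype_iff_indicator, Set.indicator_eq_self.mpr
    (support_latticePoint_inv_pow (by omega) τ)] at h'
  exact h'.norm

theorem eisensteinG_of_odd {k : ℕ} (hk : Odd k) (τ : ℍ) : eisensteinG k τ = 0 := by
  rw [eisensteinG_eq_tsum hk.pos.ne']
  have h := (Equiv.neg (ℤ × ℤ)).tsum_eq fun p => (latticePoint τ p)⁻¹ ^ k
  simp only [Equiv.neg_apply, map_neg, inv_neg, hk.neg_pow, tsum_neg] at h
  exact self_eq_neg.mp h.symm

/-- The change of variables `(x, y) ↦ (-x, y - x)` on pairs. -/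
def reflectPair (A : Type*) [AddCommGroup A] : A × A ≃ A × A where
  toFun v := (-v.1, v.2 - v.1)
  invFun v := (-v.1, v.2 - v.1)
  left_inv v := by simp
  right_inv v := by simp

theorem tsum_tripleResidue_offDiag {d : ℕ} (hd : Even d) (τ : ℍ)
    {f : (ℤ × ℤ) × (ℤ × ℤ) → ℂ}
    (hf : f = fun v => if v.1 = v.2 then 0
      else tripleResidue d (latticePoint τ v.1) (latticePoint τ v.2)) (hs : Summable f) :
    ∑' v, f v = 0 := by
  -- Since `0⁻¹ = 0` and all exponents are positive, pairs containing the origin contribute nothing.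
  have hzero : ∀ x : ℂ, tripleResidue d 0 x = 0 ∧ tripleResidue d x 0 = 0 := fun x => by
    simp [tripleResidue]
  have key : ∀ v, f v + (f (reflectPair _ v) + f (reflectPair _ v.swap)) = 0 := by
    rintro ⟨p, q⟩
    simp only [hf, reflectPair, Equiv.coe_fn_mk, Prod.swap_prod_mk]
    by_cases hp : p = 0
    · simp [hp, hzero]
    by_cases hq : q = 0
    · simp [hq, hzero]
    by_cases hpq : p = q
    · simp [hpq, hzero]
    have h1 : -p ≠ q - p := by simpa [neg_eq_iff_eq_neg, sub_eq_add_neg, eq_comm] using hq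
    have h2 : -q ≠ p - q := by simpa [neg_eq_iff_eq_neg, sub_eq_add_neg, eq_comm] using hp
    rw [if_neg hpq, if_neg h1, if_neg h2, map_neg, map_neg, map_sub, map_sub, ← add_assoc]
    exact tripleResidue_add_add_eq_zero hd (latticePoint_eq_zero.not.mpr hp)
      (latticePoint_eq_zero.not.mpr hq) ((latticePoint_injective τ).ne hpq)
  have e1 := (reflectPair (ℤ × ℤ)).tsum_eq f
  have e2 := ((Equiv.prodComm _ _).trans (reflectPair (ℤ × ℤ))).tsum_eq f
  have s1 := (reflectPair (ℤ × ℤ)).summable_iff.mpr hs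
  have s2 := ((Equiv.prodComm _ _).trans (reflectPair (ℤ × ℤ))).summable_iff.mpr hs
  have h := hs.tsum_add (s1.add s2)
  rw [s1.tsum_add s2] at h
  have h0 : ∑' v, (f v + ((f ∘ reflectPair (ℤ × ℤ)) v +
      (f ∘ (Equiv.prodComm _ _).trans (reflectPair (ℤ × ℤ))) v)) = 0 := by
    rw [← tsum_zero (α := ℂ) (β := (ℤ × ℤ) × (ℤ × ℤ))]
    exact tsum_congr key
  rw [h0] at h
  simp only [Function.comp_apply] at h
  rw [e1, e2] at h
  linear_combination -h / 3

/-- Coefficient of `X ^ d` in the square of `(1 - X)⁻¹ ^ (d + 1)`. -/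
theorem sum_antidiagonal_choose_mul_choose (d : ℕ) :
    ∑ ij ∈ Finset.HasAntidiagonal.antidiagonal d, (d + ij.1).choose d * (d + ij.2).choose d =
      (3 * d + 1).choose d := by
  have h := congrArg (PowerSeries.coeff d) (pow_add (PowerSeries.mk 1 : PowerSeries ℤ) (d + 1) (d + 1))
  rw [show d + 1 + (d + 1) = 2 * d + 1 + 1 by ring, PowerSeries.mk_one_pow_eq_mk_choose_add,
    PowerSeries.mk_one_pow_eq_mk_choose_add, PowerSeries.coeff_mk, PowerSeries.coeff_mul] at h
  simp only [PowerSeries.coeff_mk] at h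
  have h' : (2 * d + 1 + d).choose (2 * d + 1) = (3 * d + 1).choose d := by
    rw [Nat.choose_symm_add]; congr 1; ring
  rw [← h']
  exact_mod_cast h.symm

theorem tripleResidue_self (d : ℕ) (x : ℂ) :
    tripleResidue d x x = ((3 * d + 1).choose d : ℂ) * x⁻¹ ^ (3 * d + 2) := by
  rw [← sum_antidiagonal_choose_mul_choose, tripleResidue]
  push_cast
  rw [Finset.sum_mul]
  refine Finset.sum_congr rfl fun ij hij => ?_
  rw [← pow_add, ← Finset.HasAntidiagonal.mem_antidiagonal.mp hij]
  congr 2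
  ring

theorem choose_mul_eisensteinG {d : ℕ} (hd : Even d) (hd2 : 2 ≤ d) (τ : ℍ) :
    ((3 * d + 1).choose d : ℂ) * eisensteinG (3 * d + 2) τ =
      ∑ ij ∈ Finset.HasAntidiagonal.antidiagonal d,
        ((d + ij.1).choose d : ℂ) * ((d + ij.2).choose d : ℂ) *
          (eisensteinG (d + 1 + ij.1) τ * eisensteinG (d + 1 + ij.2) τ) := by
  -- Every weight is at least `d + 1 ≥ 3`, so weight 2 never occurs.
  have hsum : ∀ i, Summable fun p => ‖(latticePoint τ p)⁻¹ ^ (d + 1 + i)‖ := fun i =>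
    summable_norm_latticePoint_inv_pow (by omega) τ
  have hprod : HasSum (fun v : (ℤ × ℤ) × (ℤ × ℤ) =>
      tripleResidue d (latticePoint τ v.1) (latticePoint τ v.2))
      (∑ ij ∈ Finset.HasAntidiagonal.antidiagonal d,
        ((d + ij.1).choose d : ℂ) * ((d + ij.2).choose d : ℂ) *
          (eisensteinG (d + 1 + ij.1) τ * eisensteinG (d + 1 + ij.2) τ)) := by
    refine hasSum_sum fun ij _ => HasSum.mul_left _ ?_
    rw [eisensteinG_eq_tsum (by omega), eisensteinG_eq_tsum (by omega),
      tsum_mul_tsum_of_summable_norm (hsum _) (hsum _)]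
    exact (summable_mul_of_summable_norm (hsum _) (hsum _)).hasSum
  have hdiag : HasSum (fun p => tripleResidue d (latticePoint τ p) (latticePoint τ p))
      (((3 * d + 1).choose d : ℂ) * eisensteinG (3 * d + 2) τ) := by
    simp only [tripleResidue_self]
    rw [eisensteinG_eq_tsum (by omega)]
    exact (summable_norm_latticePoint_inv_pow (by omega) τ).of_norm.hasSum.mul_left _
  have hinj : Function.Injective fun p : ℤ × ℤ => (p, p) := fun p q h => congrArg Prod.fst h
  have hdiag' : HasSum (fun v : (ℤ × ℤ) × (ℤ × ℤ) => if v.1 = v.2 then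
      tripleResidue d (latticePoint τ v.1) (latticePoint τ v.2) else 0)
      (((3 * d + 1).choose d : ℂ) * eisensteinG (3 * d + 2) τ) := by
    refine (hinj.hasSum_iff ?_).mp (by simpa [Function.comp_def] using hdiag)
    rintro ⟨p, q⟩ h
    exact if_neg fun hpq => h ⟨p, by simpa using hpq⟩
  have hoff := hprod.sub hdiag'
  have h0 := tsum_tripleResidue_offDiag hd τ (f := fun v => _) (by
    funext v
    split_ifs with hv
    · simp
    · simp) hoff.summable
  rw [hoff.tsum_eq] at h0
  exact (sub_eq_zero.mp h0).symm

end LatticeSums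

/-! ### Matching coefficients and indices -/

theorem coefficient_identity (d i j : ℕ) (hij : i + j = d) :
    1 / (3 * (d : ℂ) + 1) * (((2 * d + 1).factorial : ℂ) / (d.factorial : ℂ) ^ 2) *
      ((d.choose i : ℂ) / ((3 * d).choose (d + i) : ℂ)) * ((3 * d + 1).choose d : ℂ) =
      ((d + i).choose d : ℂ) * ((d + j).choose d : ℂ) := by
  subst hij
  have f : ∀ m : ℕ, (m.factorial : ℂ) ≠ 0 := fun m => by exact_mod_cast m.factorial_ne_zero
  have h3 : (((3 * (i + j) + 1).factorial : ℕ) : ℂ) =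
      (3 * ((i + j : ℕ) : ℂ) + 1) * ((3 * (i + j)).factorial : ℂ) := by
    rw [Nat.factorial_succ]; push_cast; ring
  have h4 : (3 * ((i + j : ℕ) : ℂ) + 1) ≠ 0 := by exact_mod_cast Nat.succ_ne_zero (3 * (i + j))
  rw [Nat.cast_choose ℂ (by omega : i ≤ i + j), Nat.cast_choose ℂ (by omega : i + j + i ≤ 3 * (i + j)),
    Nat.cast_choose ℂ (by omega : i + j ≤ 3 * (i + j) + 1),
    Nat.cast_choose ℂ (by omega : i + j ≤ i + j + i),
    Nat.cast_choose ℂ (by omega : i + j ≤ i + j + j), h3,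
    show i + j - i = j by omega, show 3 * (i + j) - (i + j + i) = i + j + j by omega,
    show 3 * (i + j) + 1 - (i + j) = 2 * (i + j) + 1 by omega,
    show i + j + i - (i + j) = i by omega, show i + j + j - (i + j) = j by omega]
  have f1 := f i
  have f2 := f j
  have f3 := f (i + j)
  have f4 := f (i + j + i)
  have f5 := f (i + j + j)
  have f6 := f (2 * (i + j) + 1)
  have f7 := f (3 * (i + j))
  field_simp

theorem sum_antidiagonal_eq_sum_Icc {n : ℕ} (f : ℕ × ℕ → ℂ)
    (hf : ∀ ij, Even ij.1 → f ij = 0) :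
    ∑ ij ∈ Finset.HasAntidiagonal.antidiagonal (2 * n), f ij =
      ∑ k ∈ Finset.Icc 1 n, f (2 * k - 1, 2 * n - (2 * k - 1)) := by
  symm
  refine Finset.sum_of_injOn (fun k => (2 * k - 1, 2 * n - (2 * k - 1))) ?_ ?_ ?_ fun _ _ => rfl
  · intro a ha b hb hab
    simp only [Finset.coe_Icc, Set.mem_Icc, Prod.mk.injEq] at ha hb hab
    omega
  · intro k hk
    simp only [Finset.coe_Icc, Set.mem_Icc, Finset.mem_coe, Finset.HasAntidiagonal.mem_antidiagonal] at hk ⊢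
    omega
  · rintro ⟨i, j⟩ hij hn
    refine hf _ ?_
    by_contra ho
    obtain ⟨m, rfl⟩ := Nat.not_even_iff_odd.mp ho
    rw [Finset.HasAntidiagonal.mem_antidiagonal] at hij
    exact hn ⟨m + 1, by simp; omega, by simp; omega⟩

theorem theorem1p1 (n : ℕ) (hn : 1 ≤ n) (τ : ℍ) :
    eisensteinG (6 * n + 2) τ =
      1 / (6 * (n : ℂ) + 1) *
        (((4 * n + 1).factorial : ℂ) / ((2 * n).factorial : ℂ) ^ 2) *
        ∑ k ∈ Finset.Icc 1 n,
          ((Nat.choose (2 * n) (2 * k - 1) : ℂ) / (Nat.choose (6 * n) (2 * n + 2 * k - 1) : ℂ)) *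
            eisensteinG (2 * n + 2 * k) τ * eisensteinG (4 * n - 2 * k + 2) τ := by
  have h := choose_mul_eisensteinG (even_two_mul n) (by omega) τ
  rw [sum_antidiagonal_eq_sum_Icc] at h
  · have hc : ((3 * (2 * n) + 1).choose (2 * n) : ℂ) ≠ 0 := by
      exact_mod_cast (Nat.choose_pos (by omega)).ne'
    rw [show 6 * n + 2 = 3 * (2 * n) + 2 by ring]
    refine mul_left_cancel₀ hc (h.trans ?_)
    rw [Finset.mul_sum, Finset.mul_sum]
    refine Finset.sum_congr rfl fun k hk => ?_
    rw [Finset.mem_Icc] at hk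
    rw [← coefficient_identity (2 * n) (2 * k - 1) (2 * n - (2 * k - 1)) (by omega),
      show 2 * n + 1 + (2 * k - 1) = 2 * n + 2 * k by omega,
      show 2 * n + 1 + (2 * n - (2 * k - 1)) = 4 * n - 2 * k + 2 by omega,
      show 2 * n + (2 * k - 1) = 2 * n + 2 * k - 1 by omega,
      show 2 * (2 * n) + 1 = 4 * n + 1 by ring, show 3 * (2 * n) = 6 * n by ring]
    push_cast
    ring
  -- For even `i` the weight `2n + 1 + i` is odd; only `i = 2k - 1` survives.
  · rintro ⟨i, j⟩ hi
    rw [eisensteinG_of_odd (k := 2 * n + 1 + i) (by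
      have := even_two_mul n
      exact (this.add_one).add_even hi)]
    simp
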